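/- Let $n,m,p,q,T\ge 0$ and $\bar h\ge 1$ be integers, $A_0,A_1\in\mathbb R^{n\times n}$, $B\in\mathbb R^{n\times m}$, $D_0\in\mathbb R^{n\times p}$, $L_1,L_2\in\mathbb R^{q\times n}$, $D\in\mathbb R^{q\times m}$. For $K\in\mathbb R^{m\times n}$ and time-varying delays $h_1,h_2:\mathbb Z_{\ge0}\to\{0,\dots,\bar h\}$ consider the closed-loop system with disturbance $\omega(k)\in\mathbb R^p$ and performance output $z(k)\in\mathbb R^q$, $$x(k+1)=A_0x(k)+A_1x(k-h_1(k))+BKx(k-h_2(k))+D_0\omega(k),\qquad z(k)=L_1x(k)+L_2x(k-h_1(k))+DKx(k-h_2(k)).$$ *Data.* Let $u_{\rm d}:\mathbb Z\to\mathbb R^m$ and $x_{\rm d}:\mathbb Z\to\mathbb R^n$ be recorded sequences that satisfy, for constants $d_1,d_2\in\{0,\dots,\bar h\}$, the undisturbed system $x_{\rm d}(k+1)=A_0x_{\rm d}(k)+A_1x_{\rm d}(k-d_1)+Bu_{\rm d}(k-d_2)$ for $k=0,\dots,T-1$. Let $U$, $X_h$, $X_0$, $X_1$ be the matrices whose $T$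 columns, for $k=0,\dots,T-1$, are $u_{\rm d}(k-d_2)$, $x_{\rm d}(k-d_1)$, $x_{\rm d}(k)$, $x_{\rm d}(k+1)$ respectively, and suppose that $W_0=\begin{bmatrix}U\\X_h\\X_0\end{bmatrix}$ has rank $m+2n$. *Conditions.* Let $\gamma>0$ and $\varepsilon>0$. Suppose that there are symmetric positive definite matrices $\bar P,\bar S,\bar R_1,\bar R_2\in\mathbb R^{n\times n}$, matrices $\bar S_{12,1},\bar S_{12,2}\in\mathbb R^{n\times n}$ and $Q_1,Q_2,Q_3\in\mathbb R^{T\times n}$ with $$UQ_2=UQ_3=0,\quad X_hQ_1=X_hQ_3=0,\quad X_0Q_1=X_0Q_2=0,\quad X_hQ_2=X_0Q_3,$$ $$\begin{bmatrix}\bar R_i&\bar S_{12,i}\\\bar S_{12,i}^\top&\bar R_i\end{bmatrix}\ge0\ (i=1,2),\qquad \bar\Gamma=\begin{bmatrix}\bar\Phi&\kappa^\top&\kappa_{\omega}^\top\\\star&I_q&0\\\star&\star&\gamma I_p\end{bmatrix}>0,$$ where $\star$ denotes blocks determined by symmetry, $\kappa=[L_1X_0Q_3,\ L_2X_0Q_3,\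 DUQ_1,\ 0,\ 0]$, $\kappa_{\omega}=[-D_0^\top,\ 0,\ 0,\ 0,\ -\varepsilon D_0^\top]$ and $$\bar\Phi=\begin{bmatrix}\bar\Phi_{11}&\bar\Phi_{12}&\bar\Phi_{13}&-\bar S_{12,1}-\bar S_{12,2}&\bar\Phi_{15}\\ \star&2\bar R_1-\bar S_{12,1}-\bar S_{12,1}^\top&0&-\bar R_1+\bar S_{12,1}&-\varepsilon(X_1Q_2)^\top\\ \star&\star&2\bar R_2-\bar S_{12,2}-\bar S_{12,2}^\top&-\bar R_2+\bar S_{12,2}&-\varepsilon(X_1Q_1)^\top\\ \star&\star&\star&\bar R_1+\bar R_2+\bar S&0\\ \star&\star&\star&\star&\bar\Phi_{55}\end{bmatrix},$$ with $\bar\Phi_{11}=\bar P-\bar S+(1-\bar h^2)(\bar R_1+\bar R_2)-X_1Q_3-(X_1Q_3)^\top$, $\bar\Phi_{12}=-\bar R_1+\bar S_{12,1}-X_1Q_2$, $\bar\Phi_{13}=-\bar R_2+\bar S_{12,2}-X_1Q_1$, $\bar\Phi_{15}=\bar h^2(\bar R_1+\bar R_2)+X_0Q_3-\varepsilon(X_1Q_3)^\top$,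 $\bar\Phi_{55}=-\bar P-\bar h^2(\bar R_1+\bar R_2)+\varepsilon(X_0Q_3+Q_3^\top X_0^\top)$. *Conclusion.* Let $K=UQ_1(X_0Q_3)^{-1}$. Then for all delays $h_1,h_2:\mathbb Z_{\ge0}\to\{0,\dots,\bar h\}$: 1. for $\omega=0$ the origin is exponentially stable: there are $M>0$ and $\rho\in(0,1)$ such that, for every initial time $k_0\ge0$ and every solution $x$ on $k\ge k_0$, $\|x(k_0+i)\|_2\le M\rho^{i}\max_{k_0-\bar h\le j\le k_0}\|x(j)\|_2$ for all $i\ge0$; 2. the system has $L_2$-gain less than $\gamma$, the $L_2$-gain being the maximum energy amplification ratio $$\sup\Big\{\frac{\sum_{k\ge0}z(k)^\top z(k)}{\sum_{k\ge0}\omega(k)^\top\omega(k)}\ :\ 0<\sum_{k\ge0}\omega(k)^\top\omega(k)<\infty,\ x(j)=0\text{ for }-\bar h\le j\le0\Big\}<\gamma .$$ -/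

import Mathlib

open Matrix
open scoped ENNReal

namespace DelayHinf

noncomputable section

/-- The Euclidean norm `‖v‖₂ = √(vᵀ v)` of a vector `v ∈ ℝⁿ`. -/
def euclNorm {n : ℕ} (v : Fin n → ℝ) : ℝ := Real.sqrt (v ⬝ᵥ v)

/-- The data matrix `[s(i)  s(i+1)  ⋯  s(i+T-1)]` of a signal `s : ℤ → ℝⁿ`. -/
def dataMatrix {n : ℕ} (s : ℤ → Fin n → ℝ) (i : ℤ) (T : ℕ) : Matrix (Fin n) (Fin T) ℝ :=
  Matrix.of fun r c => s (i + (c : ℤ)) r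

/-- The signal `k ↦ s(k - h)` for a constant delay `h`. -/
def delayed {n : ℕ} (s : ℤ → Fin n → ℝ) (h : ℕ) : ℤ → Fin n → ℝ := fun k => s (k - (h : ℤ))

/-- The recorded input-state data `(u, x)` on the window `0, …, T-1` were produced by
`x(k+1) = A₀ x(k) + A₁ x(k - h₁) + B u(k - h₂)` with constant delays `h₁`, `h₂`. -/
def IsRecordedData {n m : ℕ} (A₀ A₁ : Matrix (Fin n) (Fin n) ℝ) (B : Matrix (Fin n) (Fin m) ℝ)
    (h₁ h₂ T : ℕ) (u : ℤ → Fin m → ℝ) (x : ℤ → Fin n → ℝ) : Prop :=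
  ∀ k : ℕ, k < T →
    x ((k : ℤ) + 1) = A₀ *ᵥ x (k : ℤ) + A₁ *ᵥ delayed x h₁ (k : ℤ) + B *ᵥ delayed u h₂ (k : ℤ)

/-- `W₀`: the matrices `U`, `Xh`, `X` stacked on top of each other. -/
def dataW {n m T : ℕ} (U : Matrix (Fin m) (Fin T) ℝ) (Xh X : Matrix (Fin n) (Fin T) ℝ) :
    Matrix (Fin m ⊕ (Fin n ⊕ Fin n)) (Fin T) ℝ :=
  fromRows U (fromRows Xh X)

/-- The `2 × 2` block matrix `[A B; ⋆ D]`, the entry `⋆` being `Bᵀ`. -/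
def symBlock {ι κ : Type} (A : Matrix ι ι ℝ) (B : Matrix ι κ ℝ) (D : Matrix κ κ ℝ) :
    Matrix (ι ⊕ κ) (ι ⊕ κ) ℝ :=
  fromBlocks A B Bᵀ D

/-- Five blocks of size `n`. -/
abbrev Five (n : ℕ) : Type := Fin n ⊕ (Fin n ⊕ (Fin n ⊕ (Fin n ⊕ Fin n)))

/-- A row of five blocks. -/
def row5 {ι : Type} {n : ℕ} (M₁ M₂ M₃ M₄ M₅ : Matrix ι (Fin n) ℝ) : Matrix ι (Five n) ℝ :=
  fromCols M₁ (fromCols M₂ (fromCols M₃ (fromCols M₄ M₅)))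

/-- The symmetric `5n × 5n` matrix of the stabilization condition, given by its upper block
triangle. Here `X₀`, `X₁` are the data matrices of `x(k)` and `x(k+1)`. -/
def PhiBar {n T : ℕ} (hbar : ℕ) (ε : ℝ) (X₀ X₁ : Matrix (Fin n) (Fin T) ℝ)
    (P S R₁ R₂ S₁ S₂ : Matrix (Fin n) (Fin n) ℝ) (Q₁ Q₂ Q₃ : Matrix (Fin T) (Fin n) ℝ) :
    Matrix (Five n) (Five n) ℝ :=
  symBlock (P - S + (1 - (hbar : ℝ) ^ 2) • (R₁ + R₂) - X₁ * Q₃ - (X₁ * Q₃)ᵀ)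
    (fromCols (-R₁ + S₁ - X₁ * Q₂)
      (fromCols (-R₂ + S₂ - X₁ * Q₁)
        (fromCols (-S₁ - S₂)
          ((hbar : ℝ) ^ 2 • (R₁ + R₂) + X₀ * Q₃ - ε • (X₁ * Q₃)ᵀ))))
    (symBlock ((2 : ℝ) • R₁ - S₁ - S₁ᵀ)
      (fromCols 0 (fromCols (-R₁ + S₁) (-(ε • (X₁ * Q₂)ᵀ))))
      (symBlock ((2 : ℝ) • R₂ - S₂ - S₂ᵀ)
        (fromCols (-R₂ + S₂) (-(ε • (X₁ * Q₁)ᵀ)))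
        (symBlock (R₁ + R₂ + S) 0
          (-P - (hbar : ℝ) ^ 2 • (R₁ + R₂) + ε • (X₀ * Q₃ + Q₃ᵀ * X₀ᵀ)))))

/-- The row `κ = [L₁ X₀ Q₃, L₂ X₀ Q₃, D U Q₁, 0, 0]`. -/
def kappa {n m q T : ℕ} (L₁ L₂ : Matrix (Fin q) (Fin n) ℝ) (D : Matrix (Fin q) (Fin m) ℝ)
    (U : Matrix (Fin m) (Fin T) ℝ) (X₀ : Matrix (Fin n) (Fin T) ℝ)
    (Q₁ Q₃ : Matrix (Fin T) (Fin n) ℝ) : Matrix (Fin q) (Five n) ℝ :=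
  row5 (L₁ * X₀ * Q₃) (L₂ * X₀ * Q₃) (D * U * Q₁) 0 0

/-- The row `κ₂ = [-D₀ᵀ, 0, 0, 0, -ε D₀ᵀ, 0]`, the last block having width `q`. -/
def kappa₂ {n p : ℕ} (q : ℕ) (ε : ℝ) (D₀ : Matrix (Fin n) (Fin p) ℝ) :
    Matrix (Fin p) (Five n ⊕ Fin q) ℝ :=
  fromCols (row5 (-D₀ᵀ) 0 0 0 (-(ε • D₀ᵀ))) 0

/-- `[Φ κᵀ; ⋆ I]`. -/
def PsiBar {n q : ℕ} (Φ : Matrix (Five n) (Five n) ℝ) (κ : Matrix (Fin q) (Five n) ℝ) :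
    Matrix (Five n ⊕ Fin q) (Five n ⊕ Fin q) ℝ :=
  symBlock Φ κᵀ 1

/-- `[Ψ κ₂ᵀ; ⋆ γ I]`. -/
def GammaBar {n p q : ℕ} (γ : ℝ) (Ψ : Matrix (Five n ⊕ Fin q) (Five n ⊕ Fin q) ℝ)
    (κ₂ : Matrix (Fin p) (Five n ⊕ Fin q) ℝ) :
    Matrix ((Five n ⊕ Fin q) ⊕ Fin p) ((Five n ⊕ Fin q) ⊕ Fin p) ℝ :=
  symBlock Ψ κ₂ᵀ (γ • (1 : Matrix (Fin p) (Fin p) ℝ))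

/-- `x` solves, for all `k ≥ k₀`, the closed-loop system
`x(k+1) = A₀ x(k) + A₁ x(k - h₁(k)) + B K x(k - h₂(k)) + D₀ ω(k)`. -/
def IsTrajectory {n m p : ℕ} (A₀ A₁ : Matrix (Fin n) (Fin n) ℝ) (B : Matrix (Fin n) (Fin m) ℝ)
    (K : Matrix (Fin m) (Fin n) ℝ) (D₀ : Matrix (Fin n) (Fin p) ℝ) (h₁ h₂ : ℕ → ℕ) (k₀ : ℕ)
    (ω : ℕ → Fin p → ℝ) (x : ℤ → Fin n → ℝ) : Prop :=
  ∀ k : ℕ, k₀ ≤ k →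
    x ((k : ℤ) + 1) = A₀ *ᵥ x (k : ℤ) + A₁ *ᵥ x ((k : ℤ) - (h₁ k : ℤ))
      + (B * K) *ᵥ x ((k : ℤ) - (h₂ k : ℤ)) + D₀ *ᵥ ω k

/-- The performance output `z(k) = L₁ x(k) + L₂ x(k - h₁(k)) + D K x(k - h₂(k))`. -/
def output {n m q : ℕ} (L₁ L₂ : Matrix (Fin q) (Fin n) ℝ) (D : Matrix (Fin q) (Fin m) ℝ)
    (K : Matrix (Fin m) (Fin n) ℝ) (h₁ h₂ : ℕ → ℕ) (x : ℤ → Fin n → ℝ) : ℕ → Fin q → ℝ :=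
  fun k => L₁ *ᵥ x (k : ℤ) + L₂ *ᵥ x ((k : ℤ) - (h₁ k : ℤ))
    + (D * K) *ᵥ x ((k : ℤ) - (h₂ k : ℤ))

/-- The origin of the undisturbed (`ω = 0`) closed-loop system with the time-varying delays
`h₁`, `h₂` is exponentially stable: `‖x(k₀ + i)‖ ≤ M ρ ^ i max_{k₀ - hbar ≤ j ≤ k₀} ‖x(j)‖` with
constants `M > 0` and `0 < ρ < 1` that depend neither on the initial time `k₀` nor on the
initial history. -/
def IsExpStable {n m p : ℕ} (A₀ A₁ : Matrix (Fin n) (Fin n) ℝ) (B : Matrix (Fin n) (Fin m) ℝ)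
    (K : Matrix (Fin m) (Fin n) ℝ) (D₀ : Matrix (Fin n) (Fin p) ℝ) (hbar : ℕ)
    (h₁ h₂ : ℕ → ℕ) : Prop :=
  ∃ M ρ : ℝ, 0 < M ∧ 0 < ρ ∧ ρ < 1 ∧
    ∀ (k₀ : ℕ) (x : ℤ → Fin n → ℝ), IsTrajectory A₀ A₁ B K D₀ h₁ h₂ k₀ (fun _ => 0) x →
      ∀ c : ℝ, (∀ j : ℤ, (k₀ : ℤ) - (hbar : ℤ) ≤ j → j ≤ (k₀ : ℤ) → euclNorm (x j) ≤ c) →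
        ∀ i : ℕ, euclNorm (x ((k₀ : ℤ) + (i : ℤ))) ≤ M * ρ ^ i * c

/-- The energy `∑ₖ s(k)ᵀ s(k) ∈ [0, ∞]` of a signal. -/
def energy {q : ℕ} (s : ℕ → Fin q → ℝ) : ℝ≥0∞ := ∑' k : ℕ, ENNReal.ofReal (s k ⬝ᵥ s k)

/-- The `L₂`-gain, as the maximum energy amplification ratio from the disturbance `ω` to the
output `z`: the supremum of `(∑ₖ z(k)ᵀ z(k)) / (∑ₖ ω(k)ᵀ ω(k))` over all nonzero disturbances of
finite energy, for zero initial history. -/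
def l2Gain {n m p q : ℕ} (A₀ A₁ : Matrix (Fin n) (Fin n) ℝ) (B : Matrix (Fin n) (Fin m) ℝ)
    (K : Matrix (Fin m) (Fin n) ℝ) (D₀ : Matrix (Fin n) (Fin p) ℝ)
    (L₁ L₂ : Matrix (Fin q) (Fin n) ℝ) (D : Matrix (Fin q) (Fin m) ℝ) (hbar : ℕ)
    (h₁ h₂ : ℕ → ℕ) : ℝ≥0∞ :=
  sSup {r : ℝ≥0∞ | ∃ (ω : ℕ → Fin p → ℝ) (x : ℤ → Fin n → ℝ),
    energy ω ≠ 0 ∧ energy ω ≠ ⊤ ∧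
    IsTrajectory A₀ A₁ B K D₀ h₁ h₂ 0 ω x ∧
    (∀ j : ℤ, -(hbar : ℤ) ≤ j → j ≤ 0 → x j = 0) ∧
    r = energy (output L₁ L₂ D K h₁ h₂ x) / energy ω}

end

end DelayHinf

/-! Put Y = X₀Q₃. By the equality constraints, multiplying X₁ = A₀X₀ + A₁Xh + BU by Q₃, Q₂, Q₁ gives
A₀Y, A₁Y, BKY: data products are the closed-loop matrices acting on ξ = Y⁻¹x. Positivity of the last
diagonal block of `PhiBar` makes Y invertible (`isUnit_of_GammaBar_posDef`).

Along ξ a Lyapunov–Krasovskii functional V is used. Its increment contains minus a window sum of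
increment energies, which `delayed_window_bound` controls for every admissible delay by Jensen and
reciprocal convexity. The resulting upper bound for ΔV + zᵀz − γωᵀω is minus the quadratic form of
`GammaBar` at the current, delayed and next states, −z and ω (`GammaBar_quadratic`).

Strict positivity leaves a margin δ(‖ξ(k+1)‖² + ‖ω(k)‖²) in `exists_dissipation`. The state part
forces exponential decay (`exists_exponential_decay`); the disturbance part, after telescoping,
lowers the gain bound strictly below γ (`sum_output_le`). -/

namespace DelayHinf

/-! ### Quadratic forms, Jensen's inequality and reciprocal convexity -/

section QuadraticForms

variable {ι κ : Type} [Fintype ι] [Fintype κ]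

lemma dotProduct_transpose_mulVec_eq (M : Matrix κ ι ℝ) (u : ι → ℝ) (v : κ → ℝ) :
    u ⬝ᵥ (Mᵀ *ᵥ v) = v ⬝ᵥ (M *ᵥ u) := by
  rw [mulVec_transpose, dotProduct_comm, ← dotProduct_mulVec]

lemma symBlock_quadratic (A : Matrix ι ι ℝ) (B : Matrix ι κ ℝ) (D : Matrix κ κ ℝ)
    (u : ι → ℝ) (v : κ → ℝ) :
    Sum.elim u v ⬝ᵥ (symBlock A B D *ᵥ Sum.elim u v)
      = u ⬝ᵥ (A *ᵥ u) + 2 * (u ⬝ᵥ (B *ᵥ v)) + v ⬝ᵥ (D *ᵥ v) := by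
  rw [symBlock, fromBlocks_mulVec, sumElim_dotProduct_sumElim]
  simp only [Sum.elim_comp_inl, Sum.elim_comp_inr, dotProduct_add,
    dotProduct_transpose_mulVec_eq]
  ring

lemma fromCols_mulVec_sumElim {ρ : Type} (A : Matrix ρ ι ℝ) (B : Matrix ρ κ ℝ)
    (u : ι → ℝ) (v : κ → ℝ) :
    fromCols A B *ᵥ Sum.elim u v = A *ᵥ u + B *ᵥ v := by
  rw [fromCols_mulVec, Sum.elim_comp_inl, Sum.elim_comp_inr]

lemma dotProduct_self_nonneg' (v : ι → ℝ) : 0 ≤ v ⬝ᵥ v :=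
  Finset.sum_nonneg fun i _ => mul_self_nonneg (v i)

lemma PosSemidef.quadratic_nonneg {M : Matrix ι ι ℝ} (hM : M.PosSemidef) (v : ι → ℝ) :
    0 ≤ v ⬝ᵥ (M *ᵥ v) := by
  simpa using hM.dotProduct_mulVec_nonneg v

/-- A positive definite quadratic form is bounded below by a multiple of the squared norm. -/
lemma PosDef.exists_lower_bound {M : Matrix ι ι ℝ} (hM : M.PosDef) :
    ∃ δ : ℝ, 0 < δ ∧ ∀ v : ι → ℝ, δ * (v ⬝ᵥ v) ≤ v ⬝ᵥ (M *ᵥ v) := by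
  have hpos : ∀ v : ι → ℝ, v ≠ 0 → 0 < v ⬝ᵥ (M *ᵥ v) := fun v hv => by
    simpa using hM.dotProduct_mulVec_pos hv
  have hcont : Continuous fun v : ι → ℝ => v ⬝ᵥ (M *ᵥ v) := by fun_prop
  have hcont₁ : Continuous fun v : ι → ℝ => v ⬝ᵥ v := by fun_prop
  have hne : ∀ v ∈ Metric.sphere (0 : ι → ℝ) 1, v ≠ 0 := fun v hv h => by
    simp [h] at hv
  have hvv : ∀ v : ι → ℝ, v ≠ 0 → 0 < v ⬝ᵥ v := fun v hv =>
    lt_of_le_of_ne (dotProduct_self_nonneg' v) fun h => hv (dotProduct_self_eq_zero.1 h.symm)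
  -- The Rayleigh quotient is scale invariant, so its minimum on the compact sup-norm sphere bounds
  -- it everywhere. The sphere is empty only in dimension zero.
  rcases (Metric.sphere (0 : ι → ℝ) 1).eq_empty_or_nonempty with he | hn
  · refine ⟨1, one_pos, fun v => ?_⟩
    have hv : v = 0 := by
      by_contra hv
      have : ‖v‖⁻¹ • v ∈ Metric.sphere (0 : ι → ℝ) 1 := by
        simp [norm_smul, inv_mul_cancel₀ (norm_ne_zero_iff.2 hv)]
      rw [he] at this
      exact this
    simp [hv]
  · obtain ⟨w, hw, hmin⟩ := (isCompact_sphere (0 : ι → ℝ) 1).exists_isMinOn hn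
      ((hcont.continuousOn).div hcont₁.continuousOn fun v hv => (hvv v (hne v hv)).ne')
    refine ⟨_, div_pos (hpos w (hne w hw)) (hvv w (hne w hw)), fun v => ?_⟩
    rcases eq_or_ne v 0 with rfl | hv
    · simp
    have hs : ‖v‖⁻¹ • v ∈ Metric.sphere (0 : ι → ℝ) 1 := by
      simp [norm_smul, inv_mul_cancel₀ (norm_ne_zero_iff.2 hv)]
    have h : w ⬝ᵥ (M *ᵥ w) / w ⬝ᵥ w ≤ (‖v‖⁻¹ • v) ⬝ᵥ (M *ᵥ (‖v‖⁻¹ • v))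
        / (‖v‖⁻¹ • v) ⬝ᵥ (‖v‖⁻¹ • v) := hmin hs
    simp only [mulVec_smul, smul_dotProduct, dotProduct_smul, smul_eq_mul] at h
    have hn0 : ‖v‖⁻¹ ≠ 0 := inv_ne_zero (norm_ne_zero_iff.2 hv)
    rw [mul_div_mul_left _ _ hn0, mul_div_mul_left _ _ hn0] at h
    exact (le_div_iff₀ (hvv v hv)).1 h

/-- A quadratic form is bounded above by a multiple of the squared norm. -/
lemma exists_quadratic_le (M : Matrix ι ι ℝ) :
    ∃ C : ℝ, 0 ≤ C ∧ ∀ v : ι → ℝ, v ⬝ᵥ (M *ᵥ v) ≤ C * (v ⬝ᵥ v) := by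
  refine ⟨∑ i, ∑ j, |M i j|, by positivity, fun v => ?_⟩
  have hsq : ∀ i, v i ^ 2 ≤ v ⬝ᵥ v := fun i => by
    rw [pow_two]
    exact Finset.single_le_sum (f := fun i => v i * v i) (fun j _ => mul_self_nonneg _)
      (Finset.mem_univ i)
  have hexp : v ⬝ᵥ (M *ᵥ v) = ∑ i, ∑ j, v i * (M i j * v j) := by
    simp only [dotProduct, mulVec, Finset.mul_sum]
  rw [hexp, Finset.sum_mul]
  refine Finset.sum_le_sum fun i _ => ?_
  rw [Finset.sum_mul]
  refine Finset.sum_le_sum fun j _ => ?_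
  have h1 : |v i * v j| ≤ v ⬝ᵥ v := by
    rw [abs_le]
    constructor <;> nlinarith [hsq i, hsq j, sq_nonneg (v i + v j), sq_nonneg (v i - v j)]
  calc v i * (M i j * v j) = M i j * (v i * v j) := by ring
    _ ≤ |M i j * (v i * v j)| := le_abs_self _
    _ = |M i j| * |v i * v j| := abs_mul _ _
    _ ≤ _ := mul_le_mul_of_nonneg_left h1 (abs_nonneg _)

lemma exists_mulVec_sq_le (M : Matrix κ ι ℝ) :
    ∃ C : ℝ, 0 ≤ C ∧ ∀ v : ι → ℝ, (M *ᵥ v) ⬝ᵥ (M *ᵥ v) ≤ C * (v ⬝ᵥ v) := by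
  obtain ⟨C, hC, h⟩ := exists_quadratic_le (Mᵀ * M)
  refine ⟨C, hC, fun v => (le_of_eq ?_).trans (h v)⟩
  rw [← mulVec_mulVec, dotProduct_transpose_mulVec_eq]

lemma sub_dotProduct_self_le (u v : ι → ℝ) :
    (u - v) ⬝ᵥ (u - v) ≤ 2 * (u ⬝ᵥ u) + 2 * (v ⬝ᵥ v) := by
  have h := dotProduct_self_nonneg' (u + v)
  simp only [dotProduct_add, add_dotProduct, dotProduct_sub, sub_dotProduct] at h ⊢
  linarith

/-- The discrete Jensen inequality for a positive semidefinite form. -/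
lemma jensen_quadratic {R : Matrix ι ι ℝ} (hR : R.PosSemidef) (N : ℕ) (v : ℕ → ι → ℝ) :
    (∑ i ∈ Finset.range N, v i) ⬝ᵥ (R *ᵥ ∑ i ∈ Finset.range N, v i)
      ≤ N * ∑ i ∈ Finset.range N, v i ⬝ᵥ (R *ᵥ v i) := by
  -- Summed over all pairwise differences, the form is twice the right side minus twice the left
  -- side of the claim.
  have h : 0 ≤ ∑ i ∈ Finset.range N, ∑ j ∈ Finset.range N,
      (v i - v j) ⬝ᵥ (R *ᵥ (v i - v j)) :=
    Finset.sum_nonneg fun i _ => Finset.sum_nonneg fun j _ =>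
      PosSemidef.quadratic_nonneg hR _
  have hx : ∑ i ∈ Finset.range N, ∑ j ∈ Finset.range N, v j ⬝ᵥ (R *ᵥ v i)
      = ∑ i ∈ Finset.range N, ∑ j ∈ Finset.range N, v i ⬝ᵥ (R *ᵥ v j) := Finset.sum_comm
  simp only [mulVec_sub, dotProduct_sub, sub_dotProduct, Finset.sum_sub_distrib, hx,
    Finset.sum_const, Finset.card_range, nsmul_eq_mul, ← Finset.mul_sum] at h
  simp only [mulVec_sum, dotProduct_sum, sum_dotProduct]
  rw [Finset.sum_comm]
  linarith

/-- Jensen's inequality combined with reciprocal convexity. -/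
lemma reciprocally_convex {R S : Matrix ι ι ℝ} (hR : R.PosSemidef)
    (hRS : (symBlock R S R).PosSemidef) (a b : ℕ) (u v : ℕ → ι → ℝ) :
    (∑ i ∈ Finset.range a, u i) ⬝ᵥ (R *ᵥ ∑ i ∈ Finset.range a, u i)
      + (∑ j ∈ Finset.range b, v j) ⬝ᵥ (R *ᵥ ∑ j ∈ Finset.range b, v j)
      + 2 * ((∑ i ∈ Finset.range a, u i) ⬝ᵥ (S *ᵥ ∑ j ∈ Finset.range b, v j))
      ≤ (a + b : ℝ) * (∑ i ∈ Finset.range a, u i ⬝ᵥ (R *ᵥ u i)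
        + ∑ j ∈ Finset.range b, v j ⬝ᵥ (R *ᵥ v j)) := by
  -- Summing over pairs bounds the cross term by b times the u-energy plus a times the v-energy.
  -- Jensen supplies a and b respectively, so both weights become a + b, with no division by a or b.
  have h : 0 ≤ ∑ i ∈ Finset.range a, ∑ j ∈ Finset.range b,
      (Sum.elim (u i) (-v j)) ⬝ᵥ (symBlock R S R *ᵥ Sum.elim (u i) (-v j)) :=
    Finset.sum_nonneg fun i _ => Finset.sum_nonneg fun j _ =>
      PosSemidef.quadratic_nonneg hRS _
  have hu := jensen_quadratic hR a u
  have hv := jensen_quadratic hR b v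
  simp only [symBlock_quadratic, mulVec_neg, dotProduct_neg, neg_dotProduct, neg_neg,
    Finset.sum_add_distrib, Finset.sum_const, Finset.card_range, nsmul_eq_mul,
    ← Finset.mul_sum, mul_neg, Finset.sum_neg_distrib] at h
  have hx : (∑ i ∈ Finset.range a, u i) ⬝ᵥ (S *ᵥ ∑ j ∈ Finset.range b, v j)
      = ∑ i ∈ Finset.range a, ∑ j ∈ Finset.range b, u i ⬝ᵥ (S *ᵥ v j) := by
    simp only [mulVec_sum, dotProduct_sum, sum_dotProduct]
    rw [Finset.sum_comm]
  rw [hx]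
  linarith

end QuadraticForms

/-! ### Sliding sums and their one-step increments -/

section WindowSums

/-- The sum of `f` over the window `k - N, …, k - 1`. -/
def windowSum (N : ℕ) (f : ℤ → ℝ) (k : ℤ) : ℝ :=
  ∑ i ∈ Finset.range N, f (k - 1 - i)

/-- The sum of `f` over the window `k - N, …, k - 1` with the weights `1, …, N`. -/
def rampSum (N : ℕ) (f : ℤ → ℝ) (k : ℤ) : ℝ :=
  ∑ i ∈ Finset.range N, ((N : ℝ) - i) * f (k - 1 - i)

variable {N : ℕ} {f : ℤ → ℝ} {k : ℤ}

lemma windowSum_succ (N : ℕ) (f : ℤ → ℝ) (k : ℤ) :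
    windowSum (N + 1) f k = windowSum N f k + f (k - 1 - N) := by
  simp [windowSum, Finset.sum_range_succ]

/-- A ramp is a stack of windows of lengths 1, …, N; this reduces its time step to that of windows.
-/
lemma rampSum_succ (N : ℕ) (f : ℤ → ℝ) (k : ℤ) :
    rampSum (N + 1) f k = rampSum N f k + windowSum (N + 1) f k := by
  simp only [rampSum, windowSum]
  rw [Finset.sum_range_succ, Finset.sum_range_succ, ← add_assoc, ← Finset.sum_add_distrib]
  push_cast
  congr 1
  · exact Finset.sum_congr rfl fun i _ => by ring
  · ring

lemma windowSum_step (N : ℕ) (f : ℤ → ℝ) (k : ℤ) :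
    windowSum N f (k + 1) = windowSum N f k + f k - f (k - N) := by
  induction N with
  | zero => simp [windowSum]
  | succ N ih =>
    rw [windowSum_succ, windowSum_succ, ih]
    push_cast
    rw [show k + 1 - 1 - (N : ℤ) = k - N by ring, show k - 1 - (N : ℤ) = k - (N + 1) by ring]
    ring

lemma rampSum_step (N : ℕ) (f : ℤ → ℝ) (k : ℤ) :
    rampSum N f (k + 1) = rampSum N f k + N * f k - windowSum N f k := by
  induction N with
  | zero => simp [rampSum, windowSum]
  | succ N ih =>
    rw [rampSum_succ, rampSum_succ, ih, windowSum_step, windowSum_succ]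
    push_cast
    rw [show k - 1 - (N : ℤ) = k - (N + 1) by ring]
    ring

lemma windowSum_nonneg (h : ∀ j, 0 ≤ f j) : 0 ≤ windowSum N f k :=
  Finset.sum_nonneg fun _ _ => h _

lemma windowSum_le {c : ℝ} (h : ∀ j, k - N ≤ j → j < k → f j ≤ c) :
    windowSum N f k ≤ N * c := by
  refine (Finset.sum_le_card_nsmul (Finset.range N) _ c fun i hi => h _ ?_ ?_).trans ?_
  · have := Finset.mem_range.1 hi
    omega
  · omega
  · simp

lemma le_windowSum (h : ∀ j, 0 ≤ f j) {j : ℤ} (h₁ : k - N ≤ j) (h₂ : j < k) :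
    f j ≤ windowSum N f k := by
  obtain ⟨i, hi⟩ := Int.eq_ofNat_of_zero_le (show 0 ≤ k - 1 - j by omega)
  have hj : j = k - 1 - i := by omega
  rw [hj]
  exact Finset.single_le_sum (f := fun i : ℕ => f (k - 1 - i)) (fun _ _ => h _)
    (Finset.mem_range.2 (by omega))

lemma rampSum_nonneg (h : ∀ j, 0 ≤ f j) : 0 ≤ rampSum N f k :=
  Finset.sum_nonneg fun i hi => mul_nonneg
    (sub_nonneg.2 (by exact_mod_cast (Finset.mem_range.1 hi).le)) (h _)

lemma rampSum_le (h : ∀ j, 0 ≤ f j) : rampSum N f k ≤ N * windowSum N f k := by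
  rw [windowSum, Finset.mul_sum]
  exact Finset.sum_le_sum fun i _ => mul_le_mul_of_nonneg_right
    (by linarith [(Nat.cast_nonneg i : (0 : ℝ) ≤ i)]) (h _)

lemma windowSum_le_rampSum (h : ∀ j, 0 ≤ f j) : windowSum N f k ≤ rampSum N f k := by
  refine Finset.sum_le_sum fun i hi => ?_
  have h1 : (i : ℝ) + 1 ≤ N := by exact_mod_cast Finset.mem_range.1 hi
  nlinarith [h (k - 1 - i)]

lemma sum_increments {ι : Type} (x : ℤ → ι → ℝ) (k : ℤ) (N : ℕ) :
    ∑ i ∈ Finset.range N, (x (k - 1 - i + 1) - x (k - 1 - i)) = x k - x (k - N) := by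
  induction N with
  | zero => simp
  | succ N ih =>
    rw [Finset.sum_range_succ, ih]
    push_cast
    rw [show k - 1 - (N : ℤ) + 1 = k - N by ring, show k - 1 - (N : ℤ) = k - (N + 1) by ring]
    abel

end WindowSums

end DelayHinf

namespace DelayHinf

/-! ### The Lyapunov–Krasovskii functional and the dissipation inequality -/

section Lyapunov

variable {n m p q T : ℕ}

lemma IsHermitian.dotProduct_mulVec_comm {R : Matrix (Fin n) (Fin n) ℝ} (hR : R.IsHermitian)
    (u v : Fin n → ℝ) : u ⬝ᵥ (R *ᵥ v) = v ⬝ᵥ (R *ᵥ u) := by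
  have h : Rᵀ = R := by simpa using hR.eq
  rw [← dotProduct_transpose_mulVec_eq, h]

/-- The Lyapunov–Krasovskii functional along the signal `x`. -/
noncomputable def lyapunov (hbar : ℕ) (P S R : Matrix (Fin n) (Fin n) ℝ) (x : ℤ → Fin n → ℝ)
    (k : ℤ) : ℝ :=
  x k ⬝ᵥ (P *ᵥ x k) + windowSum hbar (fun j => x j ⬝ᵥ (S *ᵥ x j)) k
    + hbar * rampSum hbar (fun j => (x (j + 1) - x j) ⬝ᵥ (R *ᵥ (x (j + 1) - x j))) k

lemma lyapunov_nonneg {hbar : ℕ} {P S R : Matrix (Fin n) (Fin n) ℝ} (hP : P.PosSemidef)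
    (hS : S.PosSemidef) (hR : R.PosSemidef) (x : ℤ → Fin n → ℝ) (k : ℤ) :
    0 ≤ lyapunov hbar P S R x k := by
  have h₁ := PosSemidef.quadratic_nonneg hP (x k)
  have h₂ : 0 ≤ windowSum hbar (fun j => x j ⬝ᵥ (S *ᵥ x j)) k :=
    windowSum_nonneg fun j => PosSemidef.quadratic_nonneg hS _
  have h₃ : 0 ≤ rampSum hbar
      (fun j => (x (j + 1) - x j) ⬝ᵥ (R *ᵥ (x (j + 1) - x j))) k :=
    rampSum_nonneg fun j => PosSemidef.quadratic_nonneg hR _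
  unfold lyapunov
  positivity

lemma lyapunov_step (hbar : ℕ) (P S R : Matrix (Fin n) (Fin n) ℝ) (x : ℤ → Fin n → ℝ) (k : ℤ) :
    lyapunov hbar P S R x (k + 1) - lyapunov hbar P S R x k
      = x (k + 1) ⬝ᵥ (P *ᵥ x (k + 1)) - x k ⬝ᵥ (P *ᵥ x k)
        + x k ⬝ᵥ (S *ᵥ x k) - x (k - hbar) ⬝ᵥ (S *ᵥ x (k - hbar))
        + (hbar : ℝ) ^ 2 * ((x (k + 1) - x k) ⬝ᵥ (R *ᵥ (x (k + 1) - x k)))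
        - hbar * windowSum hbar
          (fun j => (x (j + 1) - x j) ⬝ᵥ (R *ᵥ (x (j + 1) - x j))) k := by
  unfold lyapunov
  rw [windowSum_step, rampSum_step]
  ring

lemma exists_lyapunov_le (hbar : ℕ) (P S : Matrix (Fin n) (Fin n) ℝ)
    {R : Matrix (Fin n) (Fin n) ℝ} (hR : R.PosSemidef) :
    ∃ C : ℝ, 0 ≤ C ∧ ∀ (x : ℤ → Fin n → ℝ) (k : ℤ),
      lyapunov hbar P S R x k ≤ C * windowSum (hbar + 1) (fun j => x j ⬝ᵥ x j) (k + 1) := by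
  obtain ⟨a, ha, hPa⟩ := exists_quadratic_le P
  obtain ⟨b, hb, hSb⟩ := exists_quadratic_le S
  obtain ⟨c, hc, hRc⟩ := exists_quadratic_le R
  -- The three factors `hbar` come from the prefactor, the largest ramp weight and the window
  -- length; 4 comes from ‖u − v‖² ≤ 2‖u‖² + 2‖v‖².
  refine ⟨a + hbar * b + hbar * (hbar * (hbar * (c * 4))), by positivity, fun x k => ?_⟩
  set N := windowSum (hbar + 1) (fun j => x j ⬝ᵥ x j) (k + 1) with hN
  have hle : ∀ j, k - hbar ≤ j → j ≤ k → x j ⬝ᵥ x j ≤ N := fun j h₁ h₂ =>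
    le_windowSum (f := fun j => x j ⬝ᵥ x j) (fun j => dotProduct_self_nonneg' _)
      (by push_cast; omega) (by omega)
  have h₁ : x k ⬝ᵥ (P *ᵥ x k) ≤ a * N :=
    (hPa _).trans (mul_le_mul_of_nonneg_left (hle k (by omega) le_rfl) ha)
  have h₂ : windowSum hbar (fun j => x j ⬝ᵥ (S *ᵥ x j)) k ≤ hbar * (b * N) :=
    windowSum_le fun j h₁ h₂ =>
      (hSb _).trans (mul_le_mul_of_nonneg_left (hle j h₁ h₂.le) hb)
  have h₃ : windowSum hbar (fun j => (x (j + 1) - x j) ⬝ᵥ (R *ᵥ (x (j + 1) - x j))) k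
      ≤ hbar * (c * (4 * N)) :=
    windowSum_le fun j h₁ h₂ => (hRc _).trans (mul_le_mul_of_nonneg_left (by
      have := sub_dotProduct_self_le (x (j + 1)) (x j)
      have := hle j h₁ h₂.le
      have := hle (j + 1) (by omega) (by omega)
      linarith) hc)
  have h₄ : rampSum hbar (fun j => (x (j + 1) - x j) ⬝ᵥ (R *ᵥ (x (j + 1) - x j))) k
      ≤ hbar * (hbar * (c * (4 * N))) :=
    (rampSum_le fun j => PosSemidef.quadratic_nonneg hR _).trans
      (mul_le_mul_of_nonneg_left h₃ (Nat.cast_nonneg _))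
  have h₅ := mul_le_mul_of_nonneg_left h₄ (Nat.cast_nonneg (α := ℝ) hbar)
  unfold lyapunov
  linarith

/-- The lower bound of the integral term for a delay `τ` that splits the window. -/
lemma delayed_window_bound {R S : Matrix (Fin n) (Fin n) ℝ} (hR : R.PosSemidef)
    (hRS : (symBlock R S R).PosSemidef) {hbar τ : ℕ} (hτ : τ ≤ hbar) (x : ℤ → Fin n → ℝ)
    (k : ℤ) :
    (x k - x (k - τ)) ⬝ᵥ (R *ᵥ (x k - x (k - τ)))
      + (x (k - τ) - x (k - hbar)) ⬝ᵥ (R *ᵥ (x (k - τ) - x (k - hbar)))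
      + 2 * ((x k - x (k - τ)) ⬝ᵥ (S *ᵥ (x (k - τ) - x (k - hbar))))
      ≤ hbar * windowSum hbar
        (fun j => (x (j + 1) - x j) ⬝ᵥ (R *ᵥ (x (j + 1) - x j))) k := by
  -- The newest τ increments telescope to x(k) − x(k−τ), the other σ to x(k−τ) − x(k−hbar).
  obtain ⟨σ, rfl⟩ := Nat.exists_eq_add_of_le hτ
  have h := reciprocally_convex hR hRS τ σ
    (fun i => x (k - 1 - i + 1) - x (k - 1 - i))
    (fun i => x (k - τ - 1 - i + 1) - x (k - τ - 1 - i))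
  rw [sum_increments, sum_increments] at h
  rw [windowSum, Finset.sum_range_add]
  push_cast
  have e : ∀ i : ℕ, k - 1 - ((τ : ℤ) + i) = k - τ - 1 - i := fun i => by ring
  simp only [e, ← sub_sub k (τ : ℤ) (σ : ℤ)]
  exact h

/-- Descriptor method: all terms in X₀Q₃, X₁Qᵢ and D₀ assemble into 2(x + εy) paired with the
residual of the dynamics `hy`, which vanishes. Inserting −z in the output slot completes the square:
−2z·z + z·z = −z·z. -/
lemma GammaBar_quadratic (hbar : ℕ) (γ ε : ℝ) (X₀ X₁ : Matrix (Fin n) (Fin T) ℝ)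
    (U : Matrix (Fin m) (Fin T) ℝ) (P S R₁ R₂ S₁ S₂ : Matrix (Fin n) (Fin n) ℝ)
    (Q₁ Q₂ Q₃ : Matrix (Fin T) (Fin n) ℝ) (L₁ L₂ : Matrix (Fin q) (Fin n) ℝ)
    (D : Matrix (Fin q) (Fin m) ℝ) (D₀ : Matrix (Fin n) (Fin p) ℝ)
    (hR₁ : R₁.IsHermitian) (hR₂ : R₂.IsHermitian)
    (x a b c y : Fin n → ℝ) (z : Fin q → ℝ) (w : Fin p → ℝ)
    (hy : (X₀ * Q₃) *ᵥ y = (X₁ * Q₃) *ᵥ x + (X₁ * Q₂) *ᵥ a + (X₁ * Q₁) *ᵥ b + D₀ *ᵥ w)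
    (hz : z = (L₁ * X₀ * Q₃) *ᵥ x + (L₂ * X₀ * Q₃) *ᵥ a + (D * U * Q₁) *ᵥ b) :
    Sum.elim (Sum.elim (Sum.elim x (Sum.elim a (Sum.elim b (Sum.elim c y)))) (-z)) w ⬝ᵥ
      (GammaBar γ (PsiBar (PhiBar hbar ε X₀ X₁ P S R₁ R₂ S₁ S₂ Q₁ Q₂ Q₃)
        (kappa L₁ L₂ D U X₀ Q₁ Q₃)) (kappa₂ q ε D₀) *ᵥ
        Sum.elim (Sum.elim (Sum.elim x (Sum.elim a (Sum.elim b (Sum.elim c y)))) (-z)) w)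
      = x ⬝ᵥ (P *ᵥ x) - y ⬝ᵥ (P *ᵥ y) - x ⬝ᵥ (S *ᵥ x) + c ⬝ᵥ (S *ᵥ c)
        - (hbar : ℝ) ^ 2 * ((y - x) ⬝ᵥ ((R₁ + R₂) *ᵥ (y - x)))
        + ((x - a) ⬝ᵥ (R₁ *ᵥ (x - a)) + (a - c) ⬝ᵥ (R₁ *ᵥ (a - c))
          + 2 * ((x - a) ⬝ᵥ (S₁ *ᵥ (a - c))))
        + ((x - b) ⬝ᵥ (R₂ *ᵥ (x - b)) + (b - c) ⬝ᵥ (R₂ *ᵥ (b - c))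
          + 2 * ((x - b) ⬝ᵥ (S₂ *ᵥ (b - c))))
        - z ⬝ᵥ z + γ * (w ⬝ᵥ w) := by
  have hx' := congrArg (fun v => x ⬝ᵥ v) hy
  have hy' := congrArg (fun v => ε * (y ⬝ᵥ v)) hy
  have hκ : kappa L₁ L₂ D U X₀ Q₁ Q₃ *ᵥ
      Sum.elim x (Sum.elim a (Sum.elim b (Sum.elim c y))) = z := by
    simp [kappa, row5, hz, add_assoc]
  simp only [dotProduct_add] at hx' hy'
  rw [GammaBar, symBlock_quadratic, PsiBar, symBlock_quadratic,
    dotProduct_transpose_mulVec_eq, dotProduct_transpose_mulVec_eq, hκ, kappa₂,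
    fromCols_mulVec_sumElim, PhiBar, ← transpose_mul]
  simp only [symBlock_quadratic, fromCols_mulVec_sumElim, row5, add_mulVec, sub_mulVec,
    neg_mulVec, smul_mulVec, zero_mulVec, one_mulVec, dotProduct_add, dotProduct_sub,
    dotProduct_neg, dotProduct_smul, smul_eq_mul, dotProduct_zero, neg_dotProduct,
    dotProduct_transpose_mulVec_eq, mulVec_sub, sub_dotProduct]
  rw [IsHermitian.dotProduct_mulVec_comm hR₁ x a, IsHermitian.dotProduct_mulVec_comm hR₁ x y,
    IsHermitian.dotProduct_mulVec_comm hR₁ a c, IsHermitian.dotProduct_mulVec_comm hR₂ x b,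
    IsHermitian.dotProduct_mulVec_comm hR₂ x y, IsHermitian.dotProduct_mulVec_comm hR₂ b c]
  linear_combination 2 * hx' + 2 * hy'

/-- On a kernel vector placed in the fifth block the ε-term disappears, and what remains of the form
is nonpositive. -/
lemma isUnit_of_GammaBar_posDef {hbar : ℕ} {γ ε : ℝ} {X₀ X₁ : Matrix (Fin n) (Fin T) ℝ}
    {P S R₁ R₂ S₁ S₂ : Matrix (Fin n) (Fin n) ℝ} {Q₁ Q₂ Q₃ : Matrix (Fin T) (Fin n) ℝ}
    {κ : Matrix (Fin q) (Five n) ℝ} {κ₂ : Matrix (Fin p) (Five n ⊕ Fin q) ℝ}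
    (hP : P.PosSemidef) (hR₁ : R₁.PosSemidef) (hR₂ : R₂.PosSemidef)
    (hΓ : (GammaBar γ (PsiBar (PhiBar hbar ε X₀ X₁ P S R₁ R₂ S₁ S₂ Q₁ Q₂ Q₃) κ) κ₂).PosDef) :
    IsUnit (X₀ * Q₃) := by
  rw [← mulVec_injective_iff_isUnit, ← coe_mulVecLin, injective_iff_map_eq_zero]
  intro v hv
  rw [mulVecLin_apply] at hv
  obtain ⟨δ, hδ, h⟩ := PosDef.exists_lower_bound hΓ
  have h := h (Sum.elim (Sum.elim (Sum.elim 0 (Sum.elim 0 (Sum.elim 0 (Sum.elim 0 v)))) 0) 0)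
  have h₁ := PosSemidef.quadratic_nonneg hP v
  have h₂ := PosSemidef.quadratic_nonneg hR₁ v
  have h₃ := PosSemidef.quadratic_nonneg hR₂ v
  simp only [GammaBar, PsiBar, PhiBar, ← transpose_mul, symBlock_quadratic, add_mulVec,
    sub_mulVec, neg_mulVec, smul_mulVec, dotProduct_add, dotProduct_sub, dotProduct_neg,
    dotProduct_smul, smul_eq_mul, dotProduct_zero, zero_dotProduct, mulVec_zero, hv,
    dotProduct_transpose_mulVec_eq, sumElim_dotProduct_sumElim] at h
  have h₄ : 0 ≤ (hbar : ℝ) ^ 2 * (v ⬝ᵥ (R₁ *ᵥ v) + v ⬝ᵥ (R₂ *ᵥ v)) := by positivity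
  have h₅ : v ⬝ᵥ v ≤ 0 := by
    by_contra hlt
    nlinarith [mul_pos hδ (not_le.1 hlt)]
  exact dotProduct_self_eq_zero.1 (le_antisymm h₅ (dotProduct_self_nonneg' v))

/-- The dissipation inequality implied by the linear matrix inequalities. -/
lemma exists_dissipation {hbar : ℕ} {γ ε : ℝ} {X₀ X₁ : Matrix (Fin n) (Fin T) ℝ}
    {U : Matrix (Fin m) (Fin T) ℝ} {P S R₁ R₂ S₁ S₂ : Matrix (Fin n) (Fin n) ℝ}
    {Q₁ Q₂ Q₃ : Matrix (Fin T) (Fin n) ℝ} {L₁ L₂ : Matrix (Fin q) (Fin n) ℝ}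
    {D : Matrix (Fin q) (Fin m) ℝ} {D₀ : Matrix (Fin n) (Fin p) ℝ}
    (hR₁ : R₁.PosSemidef) (hR₂ : R₂.PosSemidef)
    (hΓ : (GammaBar γ (PsiBar (PhiBar hbar ε X₀ X₁ P S R₁ R₂ S₁ S₂ Q₁ Q₂ Q₃)
        (kappa L₁ L₂ D U X₀ Q₁ Q₃)) (kappa₂ q ε D₀)).PosDef)
    (hRS₁ : (symBlock R₁ S₁ R₁).PosSemidef) (hRS₂ : (symBlock R₂ S₂ R₂).PosSemidef) :
    ∃ δ : ℝ, 0 < δ ∧ ∀ (x : ℤ → Fin n → ℝ) (k : ℤ) (τ₁ τ₂ : ℕ) (w : Fin p → ℝ)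
      (z : Fin q → ℝ), τ₁ ≤ hbar → τ₂ ≤ hbar →
      (X₀ * Q₃) *ᵥ x (k + 1) = (X₁ * Q₃) *ᵥ x k + (X₁ * Q₂) *ᵥ x (k - τ₁)
        + (X₁ * Q₁) *ᵥ x (k - τ₂) + D₀ *ᵥ w →
      z = (L₁ * X₀ * Q₃) *ᵥ x k + (L₂ * X₀ * Q₃) *ᵥ x (k - τ₁)
        + (D * U * Q₁) *ᵥ x (k - τ₂) →
      lyapunov hbar P S (R₁ + R₂) x (k + 1) - lyapunov hbar P S (R₁ + R₂) x k
        + z ⬝ᵥ z - γ * (w ⬝ᵥ w) ≤ -δ * (x (k + 1) ⬝ᵥ x (k + 1) + w ⬝ᵥ w) := by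
  obtain ⟨δ, hδ, h⟩ := PosDef.exists_lower_bound hΓ
  refine ⟨δ, hδ, fun x k τ₁ τ₂ w z hτ₁ hτ₂ hx hz => ?_⟩
  have h := h (Sum.elim (Sum.elim (Sum.elim (x k) (Sum.elim (x (k - τ₁))
    (Sum.elim (x (k - τ₂)) (Sum.elim (x (k - hbar)) (x (k + 1)))))) (-z)) w)
  rw [GammaBar_quadratic hbar γ ε X₀ X₁ U P S R₁ R₂ S₁ S₂ Q₁ Q₂ Q₃ L₁ L₂ D D₀
    hR₁.isHermitian hR₂.isHermitian _ _ _ _ _ z w hx hz] at h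
  have h₁ := delayed_window_bound hR₁ hRS₁ hτ₁ x k
  have h₂ := delayed_window_bound hR₂ hRS₂ hτ₂ x k
  have hw : windowSum hbar
        (fun j => (x (j + 1) - x j) ⬝ᵥ ((R₁ + R₂) *ᵥ (x (j + 1) - x j))) k
      = windowSum hbar (fun j => (x (j + 1) - x j) ⬝ᵥ (R₁ *ᵥ (x (j + 1) - x j))) k
        + windowSum hbar (fun j => (x (j + 1) - x j) ⬝ᵥ (R₂ *ᵥ (x (j + 1) - x j))) k := by
    simp only [windowSum, add_mulVec, dotProduct_add, Finset.sum_add_distrib]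
  have hsum : x (k + 1) ⬝ᵥ x (k + 1) + w ⬝ᵥ w ≤
      Sum.elim (Sum.elim (Sum.elim (x k) (Sum.elim (x (k - τ₁))
        (Sum.elim (x (k - τ₂)) (Sum.elim (x (k - hbar)) (x (k + 1)))))) (-z)) w ⬝ᵥ
      Sum.elim (Sum.elim (Sum.elim (x k) (Sum.elim (x (k - τ₁))
        (Sum.elim (x (k - τ₂)) (Sum.elim (x (k - hbar)) (x (k + 1)))))) (-z)) w := by
    simp only [sumElim_dotProduct_sumElim]
    linarith [dotProduct_self_nonneg' (x k), dotProduct_self_nonneg' (x (k - τ₁)),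
      dotProduct_self_nonneg' (x (k - τ₂)), dotProduct_self_nonneg' (x (k - hbar)),
      dotProduct_self_nonneg' (-z)]
  have hmul := mul_le_mul_of_nonneg_left hsum hδ.le
  rw [lyapunov_step, hw]
  linarith

/-- A functional that decreases at the rate of the newest sample decays exponentially, after
the addition of a weighted window sum. -/
lemma exists_exponential_decay {hbar : ℕ} {C δ : ℝ} (hC : 0 ≤ C) (hδ : 0 < δ) :
    ∃ M r : ℝ, 0 < M ∧ 0 < r ∧ r < 1 ∧ ∀ (f V : ℤ → ℝ) (k₀ : ℕ), (∀ j, 0 ≤ f j) →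
      (∀ k, 0 ≤ V k) → (∀ k, V k ≤ C * windowSum (hbar + 1) f (k + 1)) →
      (∀ k : ℕ, k₀ ≤ k → V (k + 1) - V k ≤ -δ * f (k + 1)) →
      ∀ c : ℝ, (∀ j : ℤ, (k₀ : ℤ) - hbar ≤ j → j ≤ k₀ → f j ≤ c) →
        ∀ i : ℕ, f (k₀ + i) ≤ M * r ^ i * c := by
  set H : ℝ := (hbar : ℝ) + 1 with hH
  have hH1 : 1 ≤ H := by rw [hH]; linarith [(Nat.cast_nonneg hbar : (0 : ℝ) ≤ hbar)]
  have hH0 : 0 < H := by linarith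
  set μ := δ / H with hμ
  have hμ0 : 0 < μ := div_pos hδ hH0
  have hμH : μ * H = δ := div_mul_cancel₀ _ hH0.ne'
  -- C + μH would suffice to bound W; the factor 2 ensures μ < E, hence a positive rate 1 − μ/E.
  set E := C + 2 * μ * H with hE
  have hE0 : 0 < E := by positivity
  have hμE : μ < E := by nlinarith
  refine ⟨E * H / μ, 1 - μ / E, by positivity, by
    rw [sub_pos, div_lt_one hE0]; exact hμE, by
    have := div_pos hμ0 hE0
    linarith, ?_⟩
  intro f V k₀ hf hV hVle hstep c hc i
  set W : ℤ → ℝ := fun k => V k + μ * rampSum (hbar + 1) f (k + 1) with hW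
  have hwn : ∀ k, 0 ≤ windowSum (hbar + 1) f k := fun k => windowSum_nonneg hf
  have hWle : ∀ k, W k ≤ E * windowSum (hbar + 1) f (k + 1) := fun k => by
    have h₁ := hVle k
    have h₂ : rampSum (hbar + 1) f (k + 1) ≤ H * windowSum (hbar + 1) f (k + 1) := by
      simpa [hH] using rampSum_le (N := hbar + 1) (k := k + 1) hf
    have h₃ := mul_le_mul_of_nonneg_left h₂ hμ0.le
    have h₄ : 0 ≤ μ * H * windowSum (hbar + 1) f (k + 1) := mul_nonneg (by positivity) (hwn _)
    simp only [hW, hE]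
    linarith
  -- Since μH = δ, the ramp's gain at the newest sample cancels the decrease of V, leaving −μ times
  -- the whole window, which dominates (μ/E)W.
  have hWstep : ∀ k : ℕ, k₀ ≤ k → W (k + 1) ≤ (1 - μ / E) * W k := fun k hk => by
    have h₁ := hstep k hk
    have h₂ := rampSum_step (hbar + 1) f ((k : ℤ) + 1)
    push_cast at h₂
    have h₃ : μ / E * W k ≤ μ * windowSum (hbar + 1) f (k + 1) := by
      rw [div_mul_eq_mul_div, div_le_iff₀ hE0]
      have := mul_le_mul_of_nonneg_left (hWle k) hμ0.le
      linarith
    have h₄ : μ * (H * f (k + 1)) = δ * f (k + 1) := by rw [← mul_assoc, hμH]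
    simp only [hW] at h₃ ⊢
    rw [h₂]
    linarith
  have hr0 : 0 ≤ 1 - μ / E := by
    rw [sub_nonneg, div_le_one hE0]; exact hμE.le
  have hdecay : ∀ i : ℕ, W (k₀ + i) ≤ (1 - μ / E) ^ i * W k₀ := fun i => by
    induction i with
    | zero => simp
    | succ i ih =>
      have h := hWstep (k₀ + i) (by omega)
      push_cast at h ⊢
      rw [← add_assoc]
      refine h.trans ((mul_le_mul_of_nonneg_left ih hr0).trans (le_of_eq ?_))
      ring
  have hW0 : W k₀ ≤ E * (H * c) := (hWle _).trans (mul_le_mul_of_nonneg_left (by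
    have := windowSum_le (N := hbar + 1) (f := f) (k := (k₀ : ℤ) + 1) (c := c)
      fun j h₁ h₂ => hc j (by push_cast at h₁; omega) (by omega)
    simpa [hH] using this) hE0.le)
  have hfW : μ * f (k₀ + i) ≤ W (k₀ + i) := by
    have h₁ : f (k₀ + i) ≤ rampSum (hbar + 1) f (k₀ + i + 1) :=
      (le_windowSum hf (by push_cast; omega) (by omega)).trans (windowSum_le_rampSum hf)
    have h₂ := mul_le_mul_of_nonneg_left h₁ hμ0.le
    have h₃ := hV (k₀ + i)
    simp only [hW]
    linarith
  have hfin := (hfW.trans (hdecay i)).trans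
    (mul_le_mul_of_nonneg_left hW0 (pow_nonneg hr0 i))
  rw [mul_comm, ← le_div_iff₀ hμ0] at hfin
  refine hfin.trans (le_of_eq ?_)
  ring

end Lyapunov

end DelayHinf

namespace DelayHinf

/-! ### Transfer to the original state and to signal energies -/

section ClosedLoop

variable {n m p q T : ℕ}

lemma IsRecordedData.dataMatrix_eq {A₀ A₁ : Matrix (Fin n) (Fin n) ℝ}
    {B : Matrix (Fin n) (Fin m) ℝ} {d₁ d₂ : ℕ} {ud : ℤ → Fin m → ℝ} {xd : ℤ → Fin n → ℝ}
    (hdata : IsRecordedData A₀ A₁ B d₁ d₂ T ud xd) :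
    dataMatrix xd 1 T = A₀ * dataMatrix xd 0 T + A₁ * dataMatrix (delayed xd d₁) 0 T
      + B * dataMatrix (delayed ud d₂) 0 T := by
  ext r c
  have h := congrFun (hdata c c.2) r
  rw [add_comm] at h
  simpa [dataMatrix, Matrix.mul_apply, mulVec, dotProduct] using h

/-- Decay is proved for the squared norm of Zx; boundedness of Z and Y carries it to x, and square
roots turn r into ρ = √r. -/
lemma exists_euclNorm_decay {hbar : ℕ} {C δ : ℝ} (hC : 0 ≤ C) (hδ : 0 < δ)
    (Y Z : Matrix (Fin n) (Fin n) ℝ) :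
    ∃ M ρ : ℝ, 0 < M ∧ 0 < ρ ∧ ρ < 1 ∧ ∀ (x : ℤ → Fin n → ℝ) (V : ℤ → ℝ) (k₀ : ℕ),
      (∀ j, Y *ᵥ (Z *ᵥ x j) = x j) → (∀ k, 0 ≤ V k) →
      (∀ k, V k ≤ C * windowSum (hbar + 1) (fun j => (Z *ᵥ x j) ⬝ᵥ (Z *ᵥ x j)) (k + 1)) →
      (∀ k : ℕ, k₀ ≤ k →
        V (k + 1) - V k ≤ -δ * ((Z *ᵥ x (k + 1)) ⬝ᵥ (Z *ᵥ x (k + 1)))) →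
      ∀ c : ℝ, (∀ j : ℤ, (k₀ : ℤ) - hbar ≤ j → j ≤ k₀ → euclNorm (x j) ≤ c) →
        ∀ i : ℕ, euclNorm (x (k₀ + i)) ≤ M * ρ ^ i * c := by
  obtain ⟨a, ha, hZa⟩ := exists_mulVec_sq_le Z
  obtain ⟨b, hb, hYb⟩ := exists_mulVec_sq_le Y
  obtain ⟨M, r, hM, hr0, hr1, h⟩ := exists_exponential_decay (hbar := hbar) hC hδ
  have hN : 0 < b * M * a + 1 := by positivity
  refine ⟨√(b * M * a + 1), √r, Real.sqrt_pos.2 hN, Real.sqrt_pos.2 hr0, by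
    rw [Real.sqrt_lt' one_pos]; simpa using hr1, ?_⟩
  intro x V k₀ hYZ hV hVle hstep c hc i
  have hc0 : 0 ≤ c := (Real.sqrt_nonneg _).trans (hc k₀ (by omega) le_rfl)
  have hf := h (fun j => (Z *ᵥ x j) ⬝ᵥ (Z *ᵥ x j)) V k₀
    (fun j => dotProduct_self_nonneg' _) hV hVle hstep (a * c ^ 2)
    (fun j h₁ h₂ => (hZa _).trans (mul_le_mul_of_nonneg_left
      (Real.sqrt_le_iff.1 (hc j h₁ h₂)).2 ha)) i
  refine Real.sqrt_le_iff.2 ⟨by positivity, ?_⟩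
  rw [mul_pow, mul_pow, Real.sq_sqrt hN.le, ← pow_mul, mul_comm i 2, pow_mul,
    Real.sq_sqrt hr0.le]
  have h₁ := hYb (Z *ᵥ x (k₀ + i))
  rw [hYZ] at h₁
  have h₂ := mul_le_mul_of_nonneg_left hf hb
  have h₃ : 0 ≤ r ^ i * c ^ 2 := by positivity
  linarith

/-- A finite-horizon energy bound with ratio `g` bounds the energy in `[0, ∞]`. -/
lemma energy_le_of_sum_le {g : ℝ} (hg : 0 ≤ g) {z : ℕ → Fin q → ℝ} {w : ℕ → Fin p → ℝ}
    (h : ∀ N, ∑ k ∈ Finset.range N, z k ⬝ᵥ z k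
      ≤ g * ∑ k ∈ Finset.range N, w k ⬝ᵥ w k) :
    energy z ≤ ENNReal.ofReal g * energy w := by
  refine ENNReal.tsum_le_of_sum_range_le fun N => ?_
  rw [← ENNReal.ofReal_sum_of_nonneg fun _ _ => dotProduct_self_nonneg' _]
  refine (ENNReal.ofReal_le_ofReal (h N)).trans ?_
  rw [ENNReal.ofReal_mul hg,
    ENNReal.ofReal_sum_of_nonneg fun _ _ => dotProduct_self_nonneg' _]
  gcongr
  exact ENNReal.sum_le_tsum _

/-- V telescopes. The maximum with 0 makes the ratio nonnegative, as needed for a bound in [0, ∞].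
-/
lemma sum_output_le {γ δ : ℝ} {V : ℤ → ℝ} (hV : ∀ k, 0 ≤ V k) (hV0 : V 0 ≤ 0)
    {z : ℕ → Fin q → ℝ} {w : ℕ → Fin p → ℝ}
    (h : ∀ k : ℕ, V (k + 1) - V k + z k ⬝ᵥ z k - γ * (w k ⬝ᵥ w k) ≤ -δ * (w k ⬝ᵥ w k))
    (N : ℕ) :
    ∑ k ∈ Finset.range N, z k ⬝ᵥ z k
      ≤ max (γ - δ) 0 * ∑ k ∈ Finset.range N, w k ⬝ᵥ w k := by
  have key : V N + ∑ k ∈ Finset.range N, z k ⬝ᵥ z k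
      ≤ (γ - δ) * ∑ k ∈ Finset.range N, w k ⬝ᵥ w k := by
    induction N with
    | zero => simpa using hV0
    | succ N ih =>
      rw [Finset.sum_range_succ, Finset.sum_range_succ]
      push_cast
      linarith [h N]
  have h₁ := mul_le_mul_of_nonneg_right (le_max_left (γ - δ) 0)
    (Finset.sum_nonneg (s := Finset.range N) fun k _ => dotProduct_self_nonneg' (w k))
  linarith [hV N]

end ClosedLoop

end DelayHinf

/-! ### Assembly: stability and gain of the closed loop -/

theorem corollary2 (n m p q T hbar d₁ d₂ : ℕ)
    (A₀ A₁ : Matrix (Fin n) (Fin n) ℝ) (B : Matrix (Fin n) (Fin m) ℝ)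
    (D₀ : Matrix (Fin n) (Fin p) ℝ)
    (L₁ L₂ : Matrix (Fin q) (Fin n) ℝ) (D : Matrix (Fin q) (Fin m) ℝ)
    -- recorded data, produced by the undisturbed system with constant delays `d₁`, `d₂`
    (hd₁ : d₁ ≤ hbar) (hd₂ : d₂ ≤ hbar)
    (ud : ℤ → Fin m → ℝ) (xd : ℤ → Fin n → ℝ)
    (hdata : DelayHinf.IsRecordedData A₀ A₁ B d₁ d₂ T ud xd)
    (U : Matrix (Fin m) (Fin T) ℝ) (Xh X₀ X₁ : Matrix (Fin n) (Fin T) ℝ)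
    (hU : U = DelayHinf.dataMatrix (DelayHinf.delayed ud d₂) 0 T)
    (hXh : Xh = DelayHinf.dataMatrix (DelayHinf.delayed xd d₁) 0 T)
    (hX₀ : X₀ = DelayHinf.dataMatrix xd 0 T)
    (hX₁ : X₁ = DelayHinf.dataMatrix xd 1 T)
    (hrank : (DelayHinf.dataW U Xh X₀).rank = m + 2 * n)
    -- constants and decision variables
    (γ ε : ℝ) (hhbar : 0 < hbar) (hγ : 0 < γ) (hε : 0 < ε)
    (P S R₁ R₂ S₁ S₂ : Matrix (Fin n) (Fin n) ℝ) (Q₁ Q₂ Q₃ : Matrix (Fin T) (Fin n) ℝ)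
    (hP : P.PosDef) (hS : S.PosDef) (hR₁ : R₁.PosDef) (hR₂ : R₂.PosDef)
    -- the data-based matrix inequalities
    (hΓ : (DelayHinf.GammaBar γ
      (DelayHinf.PsiBar (DelayHinf.PhiBar hbar ε X₀ X₁ P S R₁ R₂ S₁ S₂ Q₁ Q₂ Q₃)
        (DelayHinf.kappa L₁ L₂ D U X₀ Q₁ Q₃))
      (DelayHinf.kappa₂ q ε D₀)).PosDef)
    (hRS₁ : (DelayHinf.symBlock R₁ S₁ R₁).PosSemidef)
    (hRS₂ : (DelayHinf.symBlock R₂ S₂ R₂).PosSemidef)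
    -- the equality constraints
    (hUQ₂ : U * Q₂ = 0) (hUQ₃ : U * Q₃ = 0)
    (hXhQ₁ : Xh * Q₁ = 0) (hXhQ₃ : Xh * Q₃ = 0)
    (hX₀Q₁ : X₀ * Q₁ = 0) (hX₀Q₂ : X₀ * Q₂ = 0)
    (hXhQ₂ : Xh * Q₂ = X₀ * Q₃)
    -- the feedback gain
    (K : Matrix (Fin m) (Fin n) ℝ) (hK : K = U * Q₁ * (X₀ * Q₃)⁻¹) :
    ∀ h₁ h₂ : ℕ → ℕ, (∀ k, h₁ k ≤ hbar) → (∀ k, h₂ k ≤ hbar) →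
      DelayHinf.IsExpStable A₀ A₁ B K D₀ hbar h₁ h₂ ∧
      DelayHinf.l2Gain A₀ A₁ B K D₀ L₁ L₂ D hbar h₁ h₂ < ENNReal.ofReal γ := by

  intro h₁ h₂ hh₁ hh₂
  have hX : X₁ = A₀ * X₀ + A₁ * Xh + B * U := by
    rw [hX₁, hX₀, hXh, hU]
    exact hdata.dataMatrix_eq
  have hY : IsUnit (X₀ * Q₃) :=
    DelayHinf.isUnit_of_GammaBar_posDef hP.posSemidef hR₁.posSemidef hR₂.posSemidef hΓ
  have hdet : IsUnit (X₀ * Q₃).det := (isUnit_iff_isUnit_det _).1 hY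
  have hKY : K * (X₀ * Q₃) = U * Q₁ := by
    rw [hK, nonsing_inv_mul_cancel_right _ _ hdet]
  -- Each Qᵢ annihilates two of the three data blocks, isolating one closed-loop matrix.
  have hX₁Q₃ : X₁ * Q₃ = A₀ * (X₀ * Q₃) := by
    simp only [hX, Matrix.add_mul, Matrix.mul_assoc, hXhQ₃, hUQ₃, Matrix.mul_zero, add_zero]
  have hX₁Q₂ : X₁ * Q₂ = A₁ * (X₀ * Q₃) := by
    simp only [hX, Matrix.add_mul, Matrix.mul_assoc, hXhQ₂, hUQ₂, hX₀Q₂, Matrix.mul_zero,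
      add_zero, zero_add]
  have hX₁Q₁ : X₁ * Q₁ = B * K * (X₀ * Q₃) := by
    rw [Matrix.mul_assoc B, hKY]
    simp only [hX, Matrix.add_mul, Matrix.mul_assoc, hXhQ₁, hX₀Q₁, Matrix.mul_zero, zero_add]
  set Z := (X₀ * Q₃)⁻¹ with hZ
  have hYZ : ∀ v : Fin n → ℝ, (X₀ * Q₃) *ᵥ (Z *ᵥ v) = v := fun v => by
    rw [mulVec_mulVec, hZ, mul_nonsing_inv _ hdet, one_mulVec]
  obtain ⟨δ, hδ, hdiss⟩ :=
    DelayHinf.exists_dissipation hR₁.posSemidef hR₂.posSemidef hΓ hRS₁ hRS₂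
  have hR := hR₁.posSemidef.add hR₂.posSemidef
  obtain ⟨C, hC, hVle⟩ := DelayHinf.exists_lyapunov_le hbar P S hR
  have hVnn : ∀ (x : ℤ → Fin n → ℝ) k, 0 ≤ DelayHinf.lyapunov hbar P S (R₁ + R₂) x k :=
    fun x k => DelayHinf.lyapunov_nonneg hP.posSemidef hS.posSemidef hR x k
  have hstep : ∀ (k₀ : ℕ) (ω : ℕ → Fin p → ℝ) (x : ℤ → Fin n → ℝ),
      DelayHinf.IsTrajectory A₀ A₁ B K D₀ h₁ h₂ k₀ ω x → ∀ k : ℕ, k₀ ≤ k →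
      DelayHinf.lyapunov hbar P S (R₁ + R₂) (fun j => Z *ᵥ x j) (k + 1)
        - DelayHinf.lyapunov hbar P S (R₁ + R₂) (fun j => Z *ᵥ x j) k
        + DelayHinf.output L₁ L₂ D K h₁ h₂ x k ⬝ᵥ DelayHinf.output L₁ L₂ D K h₁ h₂ x k
        - γ * (ω k ⬝ᵥ ω k)
        ≤ -δ * ((Z *ᵥ x (k + 1)) ⬝ᵥ (Z *ᵥ x (k + 1)) + ω k ⬝ᵥ ω k) := by
    intro k₀ ω x hx k hk
    refine hdiss (fun j => Z *ᵥ x j) k (h₁ k) (h₂ k) (ω k) _ (hh₁ k) (hh₂ k) ?_ ?_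
    · rw [hX₁Q₃, hX₁Q₂, hX₁Q₁]
      simp only [← mulVec_mulVec _ _ (X₀ * Q₃), hYZ]
      exact hx k hk
    · rw [Matrix.mul_assoc L₁, Matrix.mul_assoc L₂, Matrix.mul_assoc D, ← hKY,
        ← Matrix.mul_assoc D]
      simp only [← mulVec_mulVec _ _ (X₀ * Q₃), hYZ]
      rfl
  constructor
  · obtain ⟨M, ρ, hM, hρ0, hρ1, h⟩ :=
      DelayHinf.exists_euclNorm_decay (hbar := hbar) hC hδ (X₀ * Q₃) Z
    refine ⟨M, ρ, hM, hρ0, hρ1, fun k₀ x hx => ?_⟩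
    refine h x (DelayHinf.lyapunov hbar P S (R₁ + R₂) fun j => Z *ᵥ x j) k₀ (fun j => hYZ _)
      (hVnn _) (hVle _) fun k hk => ?_
    have hs := hstep k₀ _ x hx k hk
    simp only [dotProduct_zero, mul_zero, add_zero, sub_zero] at hs
    linarith [DelayHinf.dotProduct_self_nonneg' (DelayHinf.output L₁ L₂ D K h₁ h₂ x k)]
  · refine lt_of_le_of_lt (b := ENNReal.ofReal (max (γ - δ) 0)) (sSup_le ?_)
      ((ENNReal.ofReal_lt_ofReal_iff hγ).2 (max_lt (by linarith) hγ))
    rintro r ⟨ω, x, -, -, hx, hx0, rfl⟩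
    refine ENNReal.div_le_of_le_mul (DelayHinf.energy_le_of_sum_le (le_max_right _ _)
      (DelayHinf.sum_output_le (hVnn fun j => Z *ᵥ x j) ?_ fun k => ?_))
    -- V(0) is controlled by the samples −hbar, …, 0, exactly the vanishing initial history.
    · refine (hVle _ 0).trans (mul_nonpos_of_nonneg_of_nonpos hC ?_)
      refine (DelayHinf.windowSum_le (c := 0) fun j hj₁ hj₂ => ?_).trans (by simp)
      simp [hx0 j (by push_cast at hj₁; omega) (by omega)]
    · have hs := hstep 0 ω x hx k (Nat.zero_le k)
      have hn := mul_nonneg hδ.le (DelayHinf.dotProduct_self_nonneg' (Z *ᵥ x ((k : ℤ) + 1)))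
      linarith
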